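/- Let $(p_n)_{n\ge1}$, $(k_n)_{n\ge1}$ be sequences of nonnegative integers, $\Lambda_{0n}\in\mathbb R^{p_n\times k_n}$, $\sigma_{0n}>0$ and $\Sigma_{0n}=\Lambda_{0n}\Lambda_{0n}^{\mathsf T}+\sigma_{0n}^2 I_{p_n}$. Write $\|\cdot\|_2$ for the operator norm, and $a_n=O(b_n)$ if there is a constant $K$ with $a_n\le K b_n$ for all $n\ge1$. Assume that $k_n=O(1)$, $\sigma_{0n}=O(1)$, $\log p_n=O(n)$, and that there are $c_n>0$ with $c_n=O(\log p_n)$ and $$\Big\|\tfrac1{c_n}\Lambda_{0n}^{\mathsf T}\Lambda_{0n}-I_{k_n}\Big\|_2=O\big(\sqrt{k_n/p_n}\big).$$ A factor covariance of size $p$ is a matrix $\Lambda_1\Lambda_1^{\mathsf T}+\sigma_1^2I_p$ with $\sigma_1>0$ and $\Lambda_1\in\mathbb R^{p\times k_1}$ for some $k_1\ge 0$. A test is a measurable $\{0,1\}$-valued function $\phi=\phi(y_1,\dots,y_n)$; $\mathbb E_{\Sigma}$ denotes expectation when $y_1,\dots,y_n$ are i.i.d. $\mathrm N_{p_n}(0,\Sigma)$.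 Let $\epsilon_n=\sqrt{(\log p_n)^3/n}$ and $\bar\epsilon_n=\sqrt{\log p_n/n}$. Then there is an integer $J\ge1$ such that the following holds. (a) For every integer $j\ge J$ there is $C>0$ such that for all $n\ge1$ and all factor covariances $\Sigma_{1n}$ of size $p_n$ with $\|\Sigma_{0n}-\Sigma_{1n}\|_2\ge j\epsilon_n$ there is a test $\phi_{j,n}$ (which may depend on $\Sigma_{1n}$) with $$\mathbb E_{\Sigma_{0n}}\phi_{j,n}\le e^{-Cnj\bar\epsilon_n^2},\qquad \mathbb E_{\Sigma_{1n}}(1-\phi_{j,n})\le e^{-Cnj\bar\epsilon_n^2}.$$ (b) There is a single $C>0$ such that the same assertion holds for all integers $j\ge J$ and all $n\ge1$ with $j\bar\epsilon_n^2\le1$. Moreover, if $(v_n)_{n\ge1}$ is a nondecreasing sequence of positive numbers with $v_n\log p_n=O(n)$, then the same conclusions (with $J$ and the constants $C$ now possibly depending on the sequence $v$) hold with $\epsilon_n$ replaced by $v_n\sqrt{(\log p_n)^3/n}$ and $\bar\epsilon_n$ replaced by $\sqrt{v_n}\sqrt{\log p_n/n}$. -/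

import Mathlib

open MeasureTheory ProbabilityTheory
open scoped Matrix Matrix.Norms.L2Operator

/-- The factor covariance `Λ Λᵀ + σ² I` with loadings `Λ` and residual standard deviation `σ`. -/
noncomputable def factorCov {p k : ℕ} (Λ : Matrix (Fin p) (Fin k) ℝ) (σ : ℝ) :
    Matrix (Fin p) (Fin p) ℝ :=
  Λ * Λᵀ + σ ^ 2 • (1 : Matrix (Fin p) (Fin p) ℝ)

/-- The law of an i.i.d. sample `y₁, …, yₙ` from the centred Gaussian with covariance `S`. -/
noncomputable def sampleLaw {p : ℕ} (n : ℕ) (S : Matrix (Fin p) (Fin p) ℝ) :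
    Measure (Fin n → EuclideanSpace ℝ (Fin p)) :=
  Measure.pi fun _ => multivariateGaussian 0 S

/-- There is a (non-randomized) test `φ` of covariance `S₀` against covariance `S₁`, based on `n`
i.i.d. centred Gaussian observations, whose type I and type II errors are at most `δ`. -/
def HasTest {p : ℕ} (n : ℕ) (S₀ S₁ : Matrix (Fin p) (Fin p) ℝ) (δ : ℝ) : Prop :=
  ∃ φ : (Fin n → EuclideanSpace ℝ (Fin p)) → ℝ,
    Measurable φ ∧ (∀ y, φ y = 0 ∨ φ y = 1) ∧
    ∫ y, φ y ∂(sampleLaw n S₀) ≤ δ ∧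
    ∫ y, (1 - φ y) ∂(sampleLaw n S₁) ≤ δ

/-- Pervasiveness of the loadings: for some positive `c n = O(log p n)`, the matrix
`(1 / c n) (Λ n)ᵀ (Λ n)` is within `O(√(k n / p n))` of the identity in operator norm.
All matrix norms here are operator norms between Euclidean spaces. -/
def PervasiveLoadings (p k : ℕ → ℕ) (Λ : ∀ n, Matrix (Fin (p n)) (Fin (k n)) ℝ) : Prop :=
  ∃ c : ℕ → ℝ, ∃ K : ℝ, ∀ n, 1 ≤ n →
    0 < c n ∧ c n ≤ K * Real.log (p n) ∧
    ‖(1 / c n) • ((Λ n)ᵀ * Λ n) - 1‖ ≤ K * Real.sqrt ((k n : ℝ) / (p n : ℝ))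

/-- Point-versus-point tests of `Σ₀ n` against any factor covariance at operator-norm distance at
least `j * ε n`, with both errors at most `exp (-C n j (εbar n)²)`, for every integer `j ≥ J`:
first for each fixed `j` and all `n`, then with one constant `C` for all `j ≥ J`, as long as
`j (εbar n)² ≤ 1`. -/
def ExponentialTests (p : ℕ → ℕ) (S₀ : ∀ n, Matrix (Fin (p n)) (Fin (p n)) ℝ)
    (ε εbar : ℕ → ℝ) : Prop :=
  ∃ J : ℕ, 1 ≤ J ∧
    (∀ j : ℕ, J ≤ j → ∃ C : ℝ, 0 < C ∧ ∀ n : ℕ, 1 ≤ n →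
      ∀ (k₁ : ℕ) (Λ₁ : Matrix (Fin (p n)) (Fin k₁) ℝ) (σ₁ : ℝ), 0 < σ₁ →
        j * ε n ≤ ‖S₀ n - factorCov Λ₁ σ₁‖ →
        HasTest n (S₀ n) (factorCov Λ₁ σ₁) (Real.exp (-(C * n * j * εbar n ^ 2)))) ∧
    (∃ C : ℝ, 0 < C ∧ ∀ j : ℕ, J ≤ j → ∀ n : ℕ, 1 ≤ n → j * εbar n ^ 2 ≤ 1 →
      ∀ (k₁ : ℕ) (Λ₁ : Matrix (Fin (p n)) (Fin k₁) ℝ) (σ₁ : ℝ), 0 < σ₁ →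
        j * ε n ≤ ‖S₀ n - factorCov Λ₁ σ₁‖ →
        HasTest n (S₀ n) (factorCov Λ₁ σ₁) (Real.exp (-(C * n * j * εbar n ^ 2))))

/-! Let `w` be a unit eigenvector of `S₀ - S₁` whose eigenvalue has modulus `‖S₀ - S₁‖`. The
projections of the sample on `w` are i.i.d. `N(0, a)` or `N(0, b)` with `|a - b| = ‖S₀ - S₁‖`, and
the likelihood ratio test between these two laws suffices. Its errors are at most the `n`-th power
of the Hellinger affinity, hence at most `exp (-n ((a - b) / (a + b))² / 4)`
(`hasTest_of_projection`). Pervasiveness gives `a ≤ ‖S₀‖ ≤ A log p`, while `b ≤ a + |a - b|`, so the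
exponent is at least `n min ((d / (A log p))², 1) / 36` at separation `d`. For `d = j ε`, the first
term of the minimum gives `j² v² log p`, up to a constant; the second is where upper bounds on `j v
log p / n` enter. -/

namespace Matrix

/-! ### Operator norms and quadratic forms. -/

theorem l2_opNorm_transpose_mul_self {m n : ℕ} (A : Matrix (Fin m) (Fin n) ℝ) :
    ‖Aᵀ * A‖ = ‖A‖ * ‖A‖ := by
  simpa [conjTranspose_eq_transpose_of_trivial] using l2_opNorm_conjTranspose_mul_self A

theorem l2_opNorm_mul_transpose_self {m n : ℕ} (A : Matrix (Fin m) (Fin n) ℝ) :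
    ‖A * Aᵀ‖ = ‖A‖ * ‖A‖ := by
  have h := l2_opNorm_conjTranspose_mul_self Aᴴ
  rw [l2_opNorm_conjTranspose] at h
  simpa [conjTranspose_eq_transpose_of_trivial] using h

theorem l2_opNorm_one_le (n : ℕ) : ‖(1 : Matrix (Fin n) (Fin n) ℝ)‖ ≤ 1 := by
  rw [← diagonal_one, l2_opNorm_diagonal]
  exact (pi_norm_le_iff_of_nonneg zero_le_one).2 fun i => by simp

theorem dotProduct_mulVec_le_l2_opNorm {n : ℕ} (A : Matrix (Fin n) (Fin n) ℝ)
    {w : EuclideanSpace ℝ (Fin n)} (hw : ‖w‖ = 1) : w ⬝ᵥ A *ᵥ w ≤ ‖A‖ := by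
  rw [← inner_toEuclideanCLM]
  refine (real_inner_le_norm _ _).trans ?_
  have h := (toEuclideanCLM (n := Fin n) (𝕜 := ℝ) A).le_opNorm w
  rw [hw, mul_one, l2_opNorm_toEuclideanCLM] at h
  rwa [hw, one_mul]

/-- The operator norm of a real symmetric matrix is attained by its quadratic form. -/
theorem IsHermitian.exists_abs_dotProduct_mulVec_eq_l2_opNorm {n : ℕ} [NeZero n]
    {A : Matrix (Fin n) (Fin n) ℝ} (hA : A.IsHermitian) :
    ∃ w : EuclideanSpace ℝ (Fin n), ‖w‖ = 1 ∧ |w ⬝ᵥ A *ᵥ w| = ‖A‖ := by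
  have hnorm : ‖A‖ = ‖hA.eigenvalues‖ := by
    conv_lhs => rw [hA.spectral_theorem, Unitary.conjStarAlgAut_apply]
    rw [← Unitary.coe_star, CStarRing.norm_mul_coe_unitary, CStarRing.norm_coe_unitary_mul,
      l2_opNorm_diagonal]
    rfl
  obtain ⟨i, hi⟩ : ∃ i, ‖hA.eigenvalues i‖ = ‖hA.eigenvalues‖ := by
    obtain ⟨i, -, hi⟩ := Finset.exists_mem_eq_sup' (Finset.univ_nonempty (α := Fin n))
      fun i => ‖hA.eigenvalues i‖
    refine ⟨i, le_antisymm (norm_le_pi_norm _ i) ((pi_norm_le_iff_of_nonneg (norm_nonneg _)).2 ?_)⟩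
    intro j
    rw [← hi]
    exact Finset.le_sup' (fun i => ‖hA.eigenvalues i‖) (Finset.mem_univ j)
  have hw : ‖hA.eigenvectorBasis i‖ = 1 := hA.eigenvectorBasis.orthonormal.1 i
  refine ⟨hA.eigenvectorBasis i, hw, ?_⟩
  have hAw : toEuclideanCLM (𝕜 := ℝ) A (hA.eigenvectorBasis i) =
      hA.eigenvalues i • hA.eigenvectorBasis i := by
    ext1
    rw [ofLp_toEuclideanCLM, hA.mulVec_eigenvectorBasis, WithLp.ofLp_smul]
  rw [← inner_toEuclideanCLM, hAw, inner_smul_right, real_inner_self_eq_norm_sq, hw, hnorm, ← hi,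
    Real.norm_eq_abs]
  simp

end Matrix

/-! ### Factor covariances and Gaussian projections. -/

theorem factorCov_posDef {p k : ℕ} (Λ : Matrix (Fin p) (Fin k) ℝ) {σ : ℝ} (hσ : 0 < σ) :
    (factorCov Λ σ).PosDef := by
  refine Matrix.PosDef.posSemidef_add ?_ (Matrix.PosDef.one.smul (by positivity))
  simpa [Matrix.conjTranspose_eq_transpose_of_trivial] using
    Matrix.posSemidef_self_mul_conjTranspose Λ

/-- The Gram matrix `Λᵀ * Λ` is the one controlled by `PervasiveLoadings`. -/
theorem norm_factorCov_le {p k : ℕ} (Λ : Matrix (Fin p) (Fin k) ℝ) (σ : ℝ) :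
    ‖factorCov Λ σ‖ ≤ ‖Λᵀ * Λ‖ + σ ^ 2 := by
  rw [factorCov, Matrix.l2_opNorm_transpose_mul_self, ← Matrix.l2_opNorm_mul_transpose_self]
  refine (norm_add_le _ _).trans ?_
  gcongr
  rw [norm_smul, Real.norm_of_nonneg (sq_nonneg σ)]
  exact mul_le_of_le_one_right (sq_nonneg σ) (Matrix.l2_opNorm_one_le p)

/-- The law of a one-dimensional projection of a centred Gaussian vector. -/
theorem map_inner_multivariateGaussian {p : ℕ} {S : Matrix (Fin p) (Fin p) ℝ}
    (hS : S.PosSemidef) (w : EuclideanSpace ℝ (Fin p)) :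
    (multivariateGaussian 0 S).map (fun y => inner ℝ w y) =
      gaussianReal 0 (w ⬝ᵥ S *ᵥ w).toNNReal := by
  have h := IsGaussian.map_eq_gaussianReal (μ := multivariateGaussian 0 S) (innerSL ℝ w)
  have h0 : ∫ y, (innerSL ℝ w) y ∂(multivariateGaussian 0 S) = 0 := by
    rw [ContinuousLinearMap.integral_comp_id_comm, integral_id_multivariateGaussian, map_zero]
    exact IsGaussian.integrable_id
  have h1 : Var[innerSL ℝ w; multivariateGaussian 0 S] = w ⬝ᵥ S *ᵥ w := by
    rw [← covarianceBilin_multivariateGaussian (μ := 0) hS, covarianceBilin_self]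
    · rfl
    · exact IsGaussian.memLp_two_id
  rw [h0, h1] at h
  exact h

/-! ### Hellinger affinity in dimension one. -/

/-- The square root of the likelihood ratio of `N(0, b)` to `N(0, a)`. -/
noncomputable def sqrtLikelihoodRatio (a b z : ℝ) : ℝ :=
  √√(a / b) * Real.exp ((1 / a - 1 / b) / 4 * z ^ 2)

theorem sqrtLikelihoodRatio_pos {a b : ℝ} (ha : 0 < a) (hb : 0 < b) (z : ℝ) :
    0 < sqrtLikelihoodRatio a b z := by
  unfold sqrtLikelihoodRatio
  positivity

/-- This lets one threshold control both errors: where one ratio is below 1, the swapped one exceeds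
1. -/
theorem sqrtLikelihoodRatio_mul_swap {a b : ℝ} (ha : 0 < a) (hb : 0 < b) (z : ℝ) :
    sqrtLikelihoodRatio a b z * sqrtLikelihoodRatio b a z = 1 := by
  unfold sqrtLikelihoodRatio
  rw [mul_mul_mul_comm, ← Real.exp_add, ← Real.sqrt_mul (Real.sqrt_nonneg _),
    ← Real.sqrt_mul (by positivity)]
  have h : a / b * (b / a) = 1 := by field_simp
  rw [h, Real.sqrt_one, Real.sqrt_one, one_mul, Real.exp_eq_one_iff]
  ring

theorem measurable_sqrtLikelihoodRatio (a b : ℝ) : Measurable (sqrtLikelihoodRatio a b) := by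
  unfold sqrtLikelihoodRatio
  fun_prop

/-- The product is the geometric mean of the two densities, so it decays even when the ratio itself
grows. -/
theorem gaussianPDFReal_smul_sqrtLikelihoodRatio {a b : ℝ} (ha : 0 < a) (hb : 0 < b) (z : ℝ) :
    gaussianPDFReal 0 a.toNNReal z • sqrtLikelihoodRatio a b z =
      (√(2 * Real.pi * a))⁻¹ * √√(a / b) *
        Real.exp (-((a + b) / (4 * a * b)) * z ^ 2) := by
  simp only [gaussianPDFReal, sqrtLikelihoodRatio, smul_eq_mul, Real.coe_toNNReal a ha.le]
  rw [mul_mul_mul_comm, ← Real.exp_add]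
  congr 2
  field_simp
  ring

theorem integrable_sqrtLikelihoodRatio {a b : ℝ} (ha : 0 < a) (hb : 0 < b) :
    Integrable (sqrtLikelihoodRatio a b) (gaussianReal 0 a.toNNReal) := by
  have ha' : a.toNNReal ≠ 0 := by simpa using ha
  rw [gaussianReal_of_var_ne_zero _ ha', gaussianPDF_def,
    integrable_withDensity_iff_integrable_smul₀' (by fun_prop) (by simp)]
  simp only [ENNReal.toReal_ofReal (gaussianPDFReal_nonneg _ _ _),
    gaussianPDFReal_smul_sqrtLikelihoodRatio ha hb]
  exact (integrable_exp_neg_mul_sq (by positivity)).const_mul _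

/-- The Hellinger affinity of two centred Gaussian laws. -/
theorem integral_sqrtLikelihoodRatio {a b : ℝ} (ha : 0 < a) (hb : 0 < b) :
    ∫ z, sqrtLikelihoodRatio a b z ∂(gaussianReal 0 a.toNNReal) =
      √√(4 * a * b / (a + b) ^ 2) := by
  have ha' : a.toNNReal ≠ 0 := by simpa using ha
  rw [integral_gaussianReal_eq_integral_smul ha']
  simp only [gaussianPDFReal_smul_sqrtLikelihoodRatio ha hb]
  rw [integral_const_mul, integral_gaussian]
  have hpi := Real.pi_pos
  rw [← Real.sqrt_inv, mul_right_comm, ← Real.sqrt_mul (by positivity),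
    ← Real.sqrt_mul (by positivity)]
  congr 1
  refine ((Real.sqrt_eq_iff_eq_sq (by positivity) (by positivity)).2 ?_).symm
  rw [mul_pow, Real.sq_sqrt (by positivity)]
  field_simp
  ring

theorem integral_sqrtLikelihoodRatio_le {a b : ℝ} (ha : 0 < a) (hb : 0 < b) :
    ∫ z, sqrtLikelihoodRatio a b z ∂(gaussianReal 0 a.toNNReal) ≤
      Real.exp (-(((a - b) / (a + b)) ^ 2 / 4)) := by
  rw [integral_sqrtLikelihoodRatio ha hb]
  -- Here `4ab / (a + b)² = 1 - ((a - b) / (a + b))²`; the fourth root then produces the factor 1/4.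
  have h : 4 * a * b / (a + b) ^ 2 ≤ Real.exp (-((a - b) / (a + b)) ^ 2) := by
    refine le_trans (le_of_eq ?_) (Real.one_sub_le_exp_neg _)
    field_simp
    ring
  refine (Real.sqrt_le_sqrt (Real.sqrt_le_sqrt h)).trans (le_of_eq ?_)
  rw [← Real.exp_half, ← Real.exp_half]
  congr 1
  ring

/-! ### Tests from i.i.d. samples. -/

instance isProbabilityMeasure_sampleLaw {p : ℕ} (n : ℕ) (S : Matrix (Fin p) (Fin p) ℝ) :
    IsProbabilityMeasure (sampleLaw n S) := by
  unfold sampleLaw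
  infer_instance

section Product

variable {p : ℕ} {S : Matrix (Fin p) (Fin p) ℝ} {w : EuclideanSpace ℝ (Fin p)} {b : ℝ}

theorem integrable_prod_sqrtLikelihoodRatio (hS : S.PosSemidef) (ha : 0 < w ⬝ᵥ S *ᵥ w)
    (hb : 0 < b) (n : ℕ) :
    Integrable (fun y : Fin n → EuclideanSpace ℝ (Fin p) =>
      ∏ i, sqrtLikelihoodRatio (w ⬝ᵥ S *ᵥ w) b (inner ℝ w (y i))) (sampleLaw n S) := by
  have h := integrable_sqrtLikelihoodRatio ha hb
  rw [← map_inner_multivariateGaussian hS] at h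
  exact Integrable.fintype_prod fun _ => h.comp_measurable (by fun_prop)

theorem integral_prod_sqrtLikelihoodRatio_le (hS : S.PosSemidef) (ha : 0 < w ⬝ᵥ S *ᵥ w)
    (hb : 0 < b) (n : ℕ) :
    ∫ y, ∏ i, sqrtLikelihoodRatio (w ⬝ᵥ S *ᵥ w) b (inner ℝ w (y i)) ∂(sampleLaw n S) ≤
      Real.exp (-(n * ((w ⬝ᵥ S *ᵥ w - b) / (w ⬝ᵥ S *ᵥ w + b)) ^ 2 / 4)) := by
  have h := integral_sqrtLikelihoodRatio_le ha hb
  rw [← map_inner_multivariateGaussian hS, integral_map (by fun_prop)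
    (measurable_sqrtLikelihoodRatio _ _).aestronglyMeasurable] at h
  rw [sampleLaw, integral_fintype_prod_eq_pow
    (fun y => sqrtLikelihoodRatio (w ⬝ᵥ S *ᵥ w) b (inner ℝ w y)), Fintype.card_fin]
  refine (pow_le_pow_left₀
    (integral_nonneg fun y => (sqrtLikelihoodRatio_pos ha hb _).le) h n).trans (le_of_eq ?_)
  rw [← Real.exp_nat_mul]
  congr 1
  ring

end Product

/-- The likelihood ratio test between the variances of a one-dimensional projection. -/
theorem hasTest_of_projection {p : ℕ} (n : ℕ) {S₀ S₁ : Matrix (Fin p) (Fin p) ℝ}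
    (h₀ : S₀.PosSemidef) (h₁ : S₁.PosSemidef) (w : EuclideanSpace ℝ (Fin p))
    (ha : 0 < w ⬝ᵥ S₀ *ᵥ w) (hb : 0 < w ⬝ᵥ S₁ *ᵥ w) :
    HasTest n S₀ S₁ (Real.exp
      (-(n * ((w ⬝ᵥ S₀ *ᵥ w - w ⬝ᵥ S₁ *ᵥ w) / (w ⬝ᵥ S₀ *ᵥ w + w ⬝ᵥ S₁ *ᵥ w)) ^ 2 / 4))) := by
  set a := w ⬝ᵥ S₀ *ᵥ w with ha_def
  set b := w ⬝ᵥ S₁ *ᵥ w with hb_def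
  let R (a b : ℝ) (y : Fin n → EuclideanSpace ℝ (Fin p)) : ℝ :=
    ∏ i, sqrtLikelihoodRatio a b (inner ℝ w (y i))
  have hRpos {a b : ℝ} (ha : 0 < a) (hb : 0 < b) (y) : 0 < R a b y :=
    Finset.prod_pos fun i _ => sqrtLikelihoodRatio_pos ha hb _
  have hRswap (y) : R a b y * R b a y = 1 := by
    simp only [R, ← Finset.prod_mul_distrib, sqrtLikelihoodRatio_mul_swap ha hb,
      Finset.prod_const_one]
  have hRmeas : Measurable (R a b) :=
    Finset.measurable_fun_prod _ fun i _ =>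
      (measurable_sqrtLikelihoodRatio a b).comp (by fun_prop)
  have hset : MeasurableSet {y | 1 ≤ R a b y} := measurableSet_le measurable_const hRmeas
  let φ : (Fin n → EuclideanSpace ℝ (Fin p)) → ℝ := Set.indicator {y | 1 ≤ R a b y} 1
  have hφ (y) : φ y = 0 ∨ φ y = 1 := by
    by_cases hy : 1 ≤ R a b y <;> simp [φ, hy]
  have hφmeas : Measurable φ := measurable_one.indicator hset
  refine ⟨φ, hφmeas, hφ, ?_, ?_⟩
  · refine le_trans ?_ (integral_prod_sqrtLikelihoodRatio_le h₀ ha hb n)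
    refine integral_mono_of_nonneg (Filter.Eventually.of_forall fun y => ?_)
      (integrable_prod_sqrtLikelihoodRatio h₀ ha hb n) (Filter.Eventually.of_forall fun y => ?_)
    · rcases hφ y with h | h <;> simp [h]
    -- Markov-type bound: the indicator of `1 ≤ R` lies below `R`.
    · change φ y ≤ R a b y
      by_cases hy : 1 ≤ R a b y
      · simp [φ, hy]
      · simpa [φ, hy] using (hRpos ha hb y).le
  · have key := integral_prod_sqrtLikelihoodRatio_le h₁ hb ha n
    rw [← hb_def] at key
    have hsymm : ((b - a) / (b + a)) ^ 2 = ((a - b) / (a + b)) ^ 2 := by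
      rw [add_comm b a, div_pow, div_pow, ← neg_sub a b, neg_sq]
    rw [hsymm] at key
    refine le_trans ?_ key
    refine integral_mono_of_nonneg (Filter.Eventually.of_forall fun y => ?_)
      (integrable_prod_sqrtLikelihoodRatio h₁ hb ha n) (Filter.Eventually.of_forall fun y => ?_)
    · rcases hφ y with h | h <;> simp [h]
    · change 1 - φ y ≤ R b a y
      by_cases hy : 1 ≤ R a b y
      · simpa [φ, hy] using (hRpos hb ha y).le
      · have h1 : (1 : ℝ) ≤ R b a y := by
          have := hRswap y
          have := hRpos hb ha y
          nlinarith
        simpa [φ, hy] using h1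

theorem HasTest.mono {p n : ℕ} {S₀ S₁ : Matrix (Fin p) (Fin p) ℝ} {δ δ' : ℝ}
    (h : HasTest n S₀ S₁ δ) (hδ : δ ≤ δ') : HasTest n S₀ S₁ δ' := by
  obtain ⟨φ, hm, h01, h0, h1⟩ := h
  exact ⟨φ, hm, h01, h0.trans hδ, h1.trans hδ⟩

/-- Two covariances at operator-norm distance at least `d` are tested with errors exponentially
small in `n (d / (2 ‖S₀‖ + d))²`. -/
theorem hasTest_of_le_norm_sub {p : ℕ} [NeZero p] (n : ℕ) {S₀ S₁ : Matrix (Fin p) (Fin p) ℝ}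
    (h₀ : S₀.PosDef) (h₁ : S₁.PosDef) {d A : ℝ} (hd : 0 ≤ d) (hdS : d ≤ ‖S₀ - S₁‖)
    (hA : ‖S₀‖ ≤ A) :
    HasTest n S₀ S₁ (Real.exp (-(n * (d / (2 * A + d)) ^ 2 / 4))) := by
  obtain ⟨w, hw, hwn⟩ :=
    (h₀.isHermitian.sub h₁.isHermitian).exists_abs_dotProduct_mulVec_eq_l2_opNorm
  have hw0 : (w : Fin p → ℝ) ≠ 0 := by
    intro h
    have : w = 0 := by ext i; simpa using congrFun h i
    simp [this] at hw
  have ha : 0 < w ⬝ᵥ S₀ *ᵥ w := by simpa using h₀.dotProduct_mulVec_pos hw0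
  have hb : 0 < w ⬝ᵥ S₁ *ᵥ w := by simpa using h₁.dotProduct_mulVec_pos hw0
  refine (hasTest_of_projection n h₀.posSemidef h₁.posSemidef w ha hb).mono ?_
  rw [Matrix.sub_mulVec, dotProduct_sub] at hwn
  have haA := (Matrix.dotProduct_mulVec_le_l2_opNorm S₀ hw).trans hA
  generalize w ⬝ᵥ S₀ *ᵥ w = a at *
  generalize w ⬝ᵥ S₁ *ᵥ w = b at *
  rw [← hwn] at hdS
  have key : d / (2 * A + d) ≤ |(a - b) / (a + b)| := by
    rw [abs_div, abs_of_pos (add_pos ha hb), div_le_div_iff₀ (by linarith) (by linarith)]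
    -- This removes `b`, as `‖S₁‖` is not bounded; monotonicity of `x / (2A + x)` then passes from
    -- `|a - b|` to `d`.
    have h2 : a + b ≤ 2 * A + |a - b| := by linarith [neg_abs_le (a - b)]
    nlinarith [abs_nonneg (a - b), mul_le_mul_of_nonneg_left h2 hd]
  have h3 : (d / (2 * A + d)) ^ 2 ≤ ((a - b) / (a + b)) ^ 2 := by
    rw [← sq_abs ((a - b) / (a + b))]
    exact pow_le_pow_left₀ (div_nonneg hd (by linarith)) key 2
  gcongr

/-! ### Rates under pervasive loadings. -/

/-- The denominator is at most `3 * max A d`. -/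
theorem le_sq_div_two_mul_add {d A : ℝ} (hd : 0 ≤ d) (hA : 0 < A) :
    min ((d / A) ^ 2) 1 / 9 ≤ (d / (2 * A + d)) ^ 2 := by
  have h : min (d / A) 1 / 3 ≤ d / (2 * A + d) := by
    rcases le_total d A with h | h
    · rw [min_eq_left ((div_le_one hA).2 h), div_div]
      exact div_le_div_of_nonneg_left hd (by linarith) (by linarith)
    · rw [min_eq_right ((one_le_div hA).2 h), div_le_div_iff₀ (by norm_num) (by linarith)]
      linarith
  have h0 : 0 ≤ min (d / A) 1 := le_min (by positivity) zero_le_one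
  have h1 := pow_le_pow_left₀ (by positivity) h 2
  refine le_trans (le_of_eq ?_) h1
  rcases le_total (d / A) 1 with h | h
  · rw [min_eq_left h, min_eq_left (pow_le_one₀ (by positivity) h)]
    ring
  · rw [min_eq_right h, min_eq_right (one_le_pow₀ h)]
    norm_num

theorem PervasiveLoadings.exists_norm_factorCov_le {p k : ℕ → ℕ}
    {Λ : ∀ n, Matrix (Fin (p n)) (Fin (k n)) ℝ} {σ : ℕ → ℝ}
    (hΛ : PervasiveLoadings p k Λ) (hk : ∃ K : ℕ, ∀ n, 1 ≤ n → k n ≤ K)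
    (hσ : ∀ n, 1 ≤ n → 0 < σ n) (hσM : ∃ M : ℝ, ∀ n, 1 ≤ n → σ n ≤ M) :
    ∃ A : ℝ, 0 < A ∧ ∀ n, 1 ≤ n → 2 ≤ p n ∧ ‖factorCov (Λ n) (σ n)‖ ≤ A * Real.log (p n) := by
  obtain ⟨c, K, hc⟩ := hΛ
  obtain ⟨N, hN⟩ := hk
  obtain ⟨M, hM⟩ := hσM
  have hK : 0 < K := by
    obtain ⟨h0, h1, -⟩ := hc 1 le_rfl
    exact pos_of_mul_pos_left (h0.trans_le h1) (Real.log_natCast_nonneg _)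
  have hlog2 := Real.log_pos one_lt_two
  refine ⟨K * (K * √N + 1) + M ^ 2 / Real.log 2, by positivity, fun n hn => ?_⟩
  obtain ⟨h0, h1, h2⟩ := hc n hn
  -- Positivity of `c n` rules out `p n = 0` and `p n = 1`, where the logarithm is 0.
  have hlog : 0 < Real.log (p n) := pos_of_mul_pos_right (h0.trans_le h1) hK.le
  have hp2 : 2 ≤ p n := by
    have h := (Real.log_pos_iff (Nat.cast_nonneg (p n))).1 hlog
    exact_mod_cast h
  refine ⟨hp2, (norm_factorCov_le _ _).trans ?_⟩
  have hlog' : Real.log 2 ≤ Real.log (p n) :=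
    Real.log_le_log (by norm_num) (by exact_mod_cast hp2)
  have hσ2 : σ n ^ 2 ≤ M ^ 2 := pow_le_pow_left₀ (hσ n hn).le (hM n hn) 2
  have hM2 : M ^ 2 ≤ M ^ 2 / Real.log 2 * Real.log (p n) := by
    rw [div_mul_eq_mul_div, le_div_iff₀ hlog2]
    gcongr
  have hs : √((k n : ℝ) / (p n : ℝ)) ≤ √N := by
    refine Real.sqrt_le_sqrt ((div_le_self (by positivity) ?_).trans ?_)
    · exact_mod_cast one_le_two.trans hp2
    · exact_mod_cast hN n hn
  have h3 : ‖(1 / c n) • ((Λ n)ᵀ * Λ n)‖ ≤ K * √N + 1 := by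
    have := norm_add_le ((1 / c n) • ((Λ n)ᵀ * Λ n) - 1) 1
    rw [sub_add_cancel] at this
    exact this.trans (add_le_add (h2.trans (by gcongr)) (Matrix.l2_opNorm_one_le _))
  rw [norm_smul, Real.norm_of_nonneg (by positivity), one_div, inv_mul_le_iff₀ h0] at h3
  calc ‖(Λ n)ᵀ * Λ n‖ + σ n ^ 2
      ≤ K * Real.log (p n) * (K * √N + 1) + M ^ 2 / Real.log 2 * Real.log (p n) :=
        add_le_add (h3.trans (by gcongr)) (hσ2.trans hM2)
    _ = _ := by ring

theorem exponentialTests_of_norm_le {p k : ℕ → ℕ} {Λ : ∀ n, Matrix (Fin (p n)) (Fin (k n)) ℝ}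
    {σ v ε εbar : ℕ → ℝ} {A B v₀ : ℝ} (hσ : ∀ n, 1 ≤ n → 0 < σ n) (hA : 0 < A) (hv₀ : 0 < v₀)
    (hS : ∀ n, 1 ≤ n → 2 ≤ p n ∧ ‖factorCov (Λ n) (σ n)‖ ≤ A * Real.log (p n))
    (hv : ∀ n, 1 ≤ n → v₀ ≤ v n) (hB : ∀ n : ℕ, 1 ≤ n → v n * Real.log (p n) ≤ B * n)
    (hε : ∀ n, 1 ≤ n → ε n = v n * √(Real.log (p n) ^ 3 / n))
    (hεbar : ∀ n, 1 ≤ n → εbar n ^ 2 = v n * (Real.log (p n) / n)) :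
    ExponentialTests p (fun n => factorCov (Λ n) (σ n)) ε εbar := by
  have hlog : ∀ n, 1 ≤ n → 0 < Real.log (p n) := fun n hn =>
    Real.log_pos (by exact_mod_cast (hS n hn).1)
  have hB0 : 0 < B := by
    have h1 := hB 1 le_rfl
    have := mul_pos (hv₀.trans_le (hv 1 le_rfl)) (hlog 1 le_rfl)
    norm_num at h1
    linarith
  -- The two bounds on `C` serve the two branches of the minimum; `36 = 9 * 4`. Part (a) takes `D =
  -- j * B`, part (b) `D = 1`.
  have main : ∀ (C D : ℝ) (j n : ℕ), 0 < D → 1 ≤ j → 1 ≤ n → C ≤ v₀ / (36 * A ^ 2) →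
      C ≤ 1 / (36 * D) → 0 < C → j * (v n * Real.log (p n)) ≤ D * n →
      ∀ (k₁ : ℕ) (Λ₁ : Matrix (Fin (p n)) (Fin k₁) ℝ) (σ₁ : ℝ), 0 < σ₁ →
        j * ε n ≤ ‖factorCov (Λ n) (σ n) - factorCov Λ₁ σ₁‖ →
        HasTest n (factorCov (Λ n) (σ n)) (factorCov Λ₁ σ₁)
          (Real.exp (-(C * n * j * εbar n ^ 2))) := by
    intro C D j n hD hj hn hC1 hC2 hC hDn k₁ Λ₁ σ₁ hσ₁ hd
    obtain ⟨hp, hSA⟩ := hS n hn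
    have : NeZero (p n) := ⟨by omega⟩
    have hL := hlog n hn
    have hn0 : (0 : ℝ) < n := by exact_mod_cast hn
    have hj1 : (1 : ℝ) ≤ j := by exact_mod_cast hj
    have hvn := hv n hn
    have hvpos := hv₀.trans_le hvn
    have hd0 : 0 ≤ j * ε n := by
      rw [hε n hn]
      positivity
    refine (hasTest_of_le_norm_sub n (factorCov_posDef _ (hσ n hn)) (factorCov_posDef _ hσ₁)
      hd0 hd hSA).mono (Real.exp_le_exp.2 (neg_le_neg ?_))
    have h9 := le_sq_div_two_mul_add hd0 (mul_pos hA hL)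
    refine le_trans ?_ (div_le_div_of_nonneg_right
      (mul_le_mul_of_nonneg_left h9 hn0.le) (by norm_num))
    have hlhs : C * n * j * εbar n ^ 2 = C * j * (v n * Real.log (p n)) := by
      rw [hεbar n hn]
      field_simp
    have hratio : (j * ε n / (A * Real.log (p n))) ^ 2 =
        j ^ 2 * v n ^ 2 * Real.log (p n) / (A ^ 2 * n) := by
      rw [hε n hn, div_pow, mul_pow, mul_pow, Real.sq_sqrt (by positivity)]
      field_simp
    rw [hlhs, hratio]
    rw [le_div_iff₀ (by positivity)] at hC1 hC2
    rcases min_choice (j ^ 2 * v n ^ 2 * Real.log (p n) / (A ^ 2 * n)) 1 with h | h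
    · rw [h]
      -- One factor `j * v n` of the quadratic rate is spent on the constant.
      have hjv : C * (36 * A ^ 2) ≤ j * v n := by nlinarith
      have hr : n * (j ^ 2 * v n ^ 2 * Real.log (p n) / (A ^ 2 * n) / 9) / 4 =
          (j * v n) * (j * v n * Real.log (p n)) / (36 * A ^ 2) := by
        field_simp
        ring
      rw [hr, le_div_iff₀ (by positivity)]
      have := mul_le_mul_of_nonneg_right hjv
        (by positivity : 0 ≤ j * v n * Real.log (p n))
      linarith
    · rw [h]
      have := mul_le_mul_of_nonneg_left hDn hC.le
      nlinarith
  refine ⟨1, le_rfl, fun j hj => ?_, ?_⟩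
  · have hj0 : (0 : ℝ) < j := by exact_mod_cast hj
    refine ⟨min (v₀ / (36 * A ^ 2)) (1 / (36 * (j * B))), by positivity, fun n hn => ?_⟩
    refine main _ (j * B) j n (by positivity) hj hn (min_le_left _ _) (min_le_right _ _)
      (by positivity) ?_
    have := mul_le_mul_of_nonneg_left (hB n hn) hj0.le
    linarith
  · refine ⟨min (v₀ / (36 * A ^ 2)) (1 / (36 * 1)), by positivity, fun j hj n hn hjn => ?_⟩
    refine main _ 1 j n one_pos hj hn (min_le_left _ _) (min_le_right _ _) (by positivity) ?_
    have hn0 : (0 : ℝ) < n := by exact_mod_cast hn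
    rw [hεbar n hn, ← mul_div_assoc, ← mul_div_assoc, div_le_iff₀ hn0] at hjn
    exact hjn

theorem mainTheorem4 (p k : ℕ → ℕ) (Λ₀ : ∀ n, Matrix (Fin (p n)) (Fin (k n)) ℝ) (σ₀ : ℕ → ℝ)
    (hk : ∃ K : ℕ, ∀ n, 1 ≤ n → k n ≤ K)
    (hΛ : PervasiveLoadings p k Λ₀)
    (hσ : ∀ n, 1 ≤ n → 0 < σ₀ n)
    (hσM : ∃ M : ℝ, ∀ n, 1 ≤ n → σ₀ n ≤ M)
    (hp : ∃ B : ℝ, ∀ n : ℕ, 1 ≤ n → Real.log (p n) ≤ B * n) :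
    ExponentialTests p (fun n => factorCov (Λ₀ n) (σ₀ n))
      (fun n => Real.sqrt (Real.log (p n) ^ 3 / n))
      (fun n => Real.sqrt (Real.log (p n) / n)) ∧
    ∀ v : ℕ → ℝ, (∀ n, 1 ≤ n → 0 < v n) → MonotoneOn v (Set.Ici 1) →
      (∃ B : ℝ, ∀ n : ℕ, 1 ≤ n → v n * Real.log (p n) ≤ B * n) →
      ExponentialTests p (fun n => factorCov (Λ₀ n) (σ₀ n))
        (fun n => v n * Real.sqrt (Real.log (p n) ^ 3 / n))
        (fun n => Real.sqrt (v n) * Real.sqrt (Real.log (p n) / n)) := by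
  obtain ⟨A, hA, hS⟩ := hΛ.exists_norm_factorCov_le hk hσ hσM
  have hlog : ∀ n, 0 ≤ Real.log (p n) := fun n => Real.log_natCast_nonneg _
  refine ⟨?_, fun v hv hmono ⟨B, hB⟩ => ?_⟩
  · obtain ⟨B, hB⟩ := hp
    refine exponentialTests_of_norm_le (v := fun _ => 1) (B := B) hσ hA one_pos hS
      (fun _ _ => le_rfl) (by simpa using hB) (by simp) fun n _ => ?_
    rw [Real.sq_sqrt (div_nonneg (hlog n) n.cast_nonneg), one_mul]
  -- Monotonicity makes `v 1` a positive lower bound for `v`.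
  · refine exponentialTests_of_norm_le (v := v) (B := B) hσ hA (hv 1 le_rfl) hS
      (fun n hn => hmono Set.self_mem_Ici hn hn) hB (fun _ _ => rfl) fun n hn => ?_
    rw [mul_pow, Real.sq_sqrt (hv n hn).le, Real.sq_sqrt (div_nonneg (hlog n) n.cast_nonneg)]
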